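/- Let $X$ be a uniform space (for instance a metric space) and let $f : X \to X$ be continuous. The topological entropy of $f$ is taken in Bowen's sense, $h(f) = \sup_{K} h(f,K)$ over all compact $K \subset X$, where $h(f,K)$ is the supremum over all entourages $U$ (in a metric space: over all $\varepsilon > 0$) of the exponential growth rate $$\limsup_{m\to\infty} \tfrac1m \ln N_m(K,U),$$ with $N_m(K,U)$ the least number of sets $\{y : (f^k(c), f^k(y)) \in U,\ 0 \le k < m\}$, $c \in X$, that cover $K$; if $X$ is compact, then $h(f) = h(f,X)$ is the usual topological entropy. Let $A$ be an $n \times n$ matrix with entries in $\{0,1\}$, and let $$\Sigma_A = \{x \in \{1,\dots,n\}^{\mathbb Z} : A(x_{k+1},x_k) = 1 \text{ for all } k \in \mathbb Z\},$$ with the topology induced by the product of the discrete topologies, and $\sigma : \Sigma_A \to \Sigma_A$, $(\sigma x)_k = x_{k+1}$, the shift map. Let $S \subset X$ be a compact set with $f(S) \subset S$, and suppose that there exists a continuous surjective map $\pi : S \to \Sigma_A$ satisfying $\sigma \circ \pi = \pi \circ f|_S$. Then $$h(f) \;\ge\; \ln\bigl(\max\{|\lambda| : \lambda \in \mathbb C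 \text{ is an eigenvalue of } A\}\bigr),$$ with the conventions that $\ln 0 = -\infty$, that the maximum is $0$ when $n=0$, and that $h(f)$ takes values in $[-\infty,+\infty]$. -/

import Mathlib

/-- The space `Σ_A` of bi-infinite sequences `x : ℤ → {1, …, n}` that are admissible for the
transition matrix `A`, i.e. `A (x (k + 1)) (x k) = 1` for all `k`. Its topology is the one induced
by the product topology on `ℤ → Fin n`, where `Fin n` is discrete. -/
def AdmissibleSeq {n : ℕ} (A : Matrix (Fin n) (Fin n) ℂ) : Set (ℤ → Fin n) :=
  {x | ∀ k : ℤ, A (x (k + 1)) (x k) = 1}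

/-- The shift map `σ : Σ_A → Σ_A`, `(σ x) k = x (k + 1)`. -/
def shiftMap {n : ℕ} (A : Matrix (Fin n) (Fin n) ℂ) (x : AdmissibleSeq A) : AdmissibleSeq A :=
  ⟨fun k => x.1 (k + 1), fun k => x.2 (k + 1)⟩

/-- Bowen's topological entropy of a self-map of a uniform (for instance metric) space: the
supremum over all compact sets `K` of the exponential growth rate, in the limit of small entourages
(small `ε`), of the least number of dynamical balls of length `m` that cover `K`. -/
noncomputable def topologicalEntropy {X : Type*} [UniformSpace X] (f : X → X) : EReal :=
  ⨆ (K : Set X) (_ : IsCompact K), Dynamics.coverEntropy f K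

/-- On a compact space the supremum is attained at the whole space. -/
theorem topologicalEntropy_eq_of_compactSpace {X : Type*} [UniformSpace X] [CompactSpace X]
    (f : X → X) : topologicalEntropy f = Dynamics.coverEntropy f Set.univ :=
  le_antisymm
    (iSup₂_le fun K _ => Dynamics.coverEntropy_monotone f (Set.subset_univ K))
    (le_iSup₂_of_le Set.univ isCompact_univ le_rfl)

open Dynamics ExpGrowth Filter Set Uniformity

/-! Entropy does not increase under factors, so it suffices to bound the shift from below at the
single scale `sameSymbol A`, whose preimage under `π` is an entourage of the compact set `S`. There,
`ρ(A) ^ k ≤ ‖A ^ k‖` is at most the number of `k`-step paths. A finite path need not extend to a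
point of `Σ_A`, but after discarding `n` steps at each end the rest does: by pigeonhole each end
repeats a vertex, and the resulting loop can be run forever. The discarded symbols cost a factor
independent of `m`, invisible to the growth rate. -/

/-- A sequence that is a path of the relation `R` on a long enough interval `[c, b]` can be modified
after time `c` to be a path of `R` on all of `[c, ∞)`. -/
lemma exists_forward_path {α : Type*} [Fintype α] (R : α → α → Prop) (v : ℤ → α) (c b : ℤ)
    (hcb : c + Fintype.card α ≤ b) (hv : ∀ z, c ≤ z → z < b → R (v z) (v (z + 1))) :
    ∃ x : ℤ → α, (∀ z ≤ c, x z = v z) ∧ ∀ z, c ≤ z → R (x z) (x (z + 1)) := by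
  obtain ⟨i, j, hci, hij, hjb, hvij⟩ : ∃ i j : ℤ, c ≤ i ∧ i < j ∧ j ≤ b ∧ v i = v j := by
    obtain ⟨s, t, hst, hvst⟩ := Fintype.exists_ne_map_eq_of_card_lt
      (fun t : Fin (Fintype.card α + 1) => v (c + (t : ℕ))) (by simp)
    have hs := s.2
    have ht := t.2
    have hne := Fin.val_ne_of_ne hst
    rcases lt_or_gt_of_ne hne with h | h
    · exact ⟨c + (s : ℕ), c + (t : ℕ), by omega, by omega, by omega, hvst⟩
    · exact ⟨c + (t : ℕ), c + (s : ℕ), by omega, by omega, by omega, hvst.symm⟩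
  -- Follow `v` up to time `i`, then run around the cycle `v i, …, v (j - 1)` forever.
  refine ⟨fun z => if z < i then v z else v (i + (z - i) % (j - i)), fun z hz => ?_, fun z hz => ?_⟩
  · rcases hz.trans hci |>.lt_or_eq with h | rfl
    · simp [h]
    · simp
  · have hp : 0 < j - i := by lia
    rcases lt_or_ge z i with h | h
    · have hR := hv z hz (by lia)
      rcases (show z + 1 ≤ i by lia).lt_or_eq with h' | h'
      · simpa [h, h'] using hR
      · have : ¬ z + 1 < i := by lia
        simp only [h, this, if_true, if_false]
        rw [h', sub_self, Int.zero_emod, add_zero, ← h']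
        exact hR
    · have h' : ¬ z + 1 < i := by lia
      simp only [h.not_gt, h', if_false]
      have h0 := Int.emod_nonneg (z - i) hp.ne'
      have h1 := Int.emod_lt_of_pos (z - i) hp
      have hR := hv (i + (z - i) % (j - i)) (by lia) (by lia)
      have hstep : (z + 1 - i) % (j - i) = ((z - i) % (j - i) + 1) % (j - i) := by
        rw [Int.emod_add_emod]; congr 1; ring
      rcases (show (z - i) % (j - i) + 1 ≤ j - i by lia).lt_or_eq with h2 | h2
      · rw [hstep, Int.emod_eq_of_lt (by lia) h2, ← add_assoc]
        exact hR
      · rw [hstep, h2, Int.emod_self, add_zero, hvij]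
        convert hR using 2
        lia

/-- A path of `R` on `[a, b]` agrees, away from the ends, with a bi-infinite path. -/
lemma exists_biinfinite_path {α : Type*} [Fintype α] (R : α → α → Prop) (v : ℤ → α) (a b c d : ℤ)
    (hac : a + Fintype.card α ≤ c) (hcd : c ≤ d) (hdb : d + Fintype.card α ≤ b)
    (hv : ∀ z, a ≤ z → z < b → R (v z) (v (z + 1))) :
    ∃ x : ℤ → α, (∀ z, c ≤ z → z ≤ d → x z = v z) ∧ ∀ z, R (x z) (x (z + 1)) := by
  obtain ⟨x, hxv, hx⟩ := exists_forward_path R v d b hdb fun z h h' => hv z (by lia) h'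
  have hx' : ∀ z, a ≤ z → R (x z) (x (z + 1)) := fun z hz => by
    rcases lt_or_ge z d with h | h
    · rw [hxv z h.le, hxv (z + 1) (by lia)]
      exact hv z hz (by lia)
    · exact hx z h
  -- The past is treated by reversing time and the relation.
  obtain ⟨y, hyx, hy⟩ := exists_forward_path (flip R) (fun z => x (-z)) (-c) (-a) (by lia)
    fun z _ h' => by
      have := hx' (-(z + 1)) (by lia)
      rwa [show -(z + 1) + 1 = -z by ring] at this
  refine ⟨fun z => y (-z), fun z h h' => ?_, fun z => ?_⟩
  · simp [hyx (-z) (by lia), hxv z h']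
  · rcases lt_or_ge z c with h | h
    · have := hy (-(z + 1)) (by lia)
      rwa [show -(z + 1) + 1 = -z by ring] at this
    · change R (y (-z)) (y (-(z + 1)))
      rw [hyx (-z) (by lia), hyx (-(z + 1)) (by lia)]
      simpa using hx' z (by lia)

/-- The paths with `k` steps in the transition graph of `A` that start at `j`. -/
noncomputable def pathsFrom {n : ℕ} (A : Matrix (Fin n) (Fin n) ℂ) (k : ℕ) (j : Fin n) :
    Finset (Fin (k + 1) → Fin n) := by
  classical
  exact {w | w 0 = j ∧ ∀ t : Fin k, A (w t.succ) (w t.castSucc) = 1}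

lemma mem_pathsFrom {n : ℕ} {A : Matrix (Fin n) (Fin n) ℂ} {k : ℕ} {j : Fin n}
    {w : Fin (k + 1) → Fin n} :
    w ∈ pathsFrom A k j ↔ w 0 = j ∧ ∀ t : Fin k, A (w t.succ) (w t.castSucc) = 1 := by
  simp [pathsFrom]

lemma sum_card_pathsFrom_le {n : ℕ} (A : Matrix (Fin n) (Fin n) ℂ) (k : ℕ) (j : Fin n)
    (s : Finset (Fin n)) (hs : ∀ l ∈ s, A l j = 1) :
    ∑ l ∈ s, (pathsFrom A k l).card ≤ (pathsFrom A (k + 1) j).card := by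
  classical
  rw [← Finset.card_biUnion fun l _ l' _ hl => Finset.disjoint_left.2 fun w hw hw' =>
    hl ((mem_pathsFrom.1 hw).1.symm.trans (mem_pathsFrom.1 hw').1)]
  refine Finset.card_le_card_of_injOn (fun w => Fin.cons j w) (fun w hw => ?_)
    fun w _ w' _ h => Fin.cons_right_injective (α := fun _ => Fin n) j h
  obtain ⟨l, hl, hw⟩ := Finset.mem_biUnion.1 hw
  obtain ⟨hw0, hw⟩ := mem_pathsFrom.1 hw
  refine mem_pathsFrom.2 ⟨rfl, fun t => ?_⟩
  refine Fin.cases ?_ (fun t => ?_) t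
  · simpa [hw0] using hs l hl
  · simpa [← Fin.succ_castSucc] using hw t

/-- Induction on the first step `j → l`, using `A ^ (k + 1) = A ^ k * A`. -/
lemma sum_nnnorm_pow_apply_le {n : ℕ} {A : Matrix (Fin n) (Fin n) ℂ}
    (hA : ∀ i j, A i j = 0 ∨ A i j = 1) (k : ℕ) (j : Fin n) :
    ∑ i, ‖(A ^ k) i j‖₊ ≤ (pathsFrom A k j).card := by
  classical
  induction k generalizing j with
  | zero =>
    have : (fun _ => j) ∈ pathsFrom A 0 j := mem_pathsFrom.2 ⟨rfl, fun t => t.elim0⟩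
    have h1 : 1 ≤ (pathsFrom A 0 j).card := Finset.card_pos.2 ⟨_, this⟩
    have h2 : ∑ i, ‖(A ^ 0) i j‖₊ = 1 := by
      rw [Finset.sum_eq_single j] <;> simp +contextual
    rw [h2]
    exact_mod_cast h1
  | succ k ih =>
    calc ∑ i, ‖(A ^ (k + 1)) i j‖₊
        ≤ ∑ i, ∑ l, ‖(A ^ k) i l‖₊ * ‖A l j‖₊ := by
          refine Finset.sum_le_sum fun i _ => ?_
          rw [pow_succ, Matrix.mul_apply]
          exact (nnnorm_sum_le _ _).trans_eq (by simp)
      _ = ∑ l, ‖A l j‖₊ * ∑ i, ‖(A ^ k) i l‖₊ := by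
          rw [Finset.sum_comm]
          simp [Finset.mul_sum, mul_comm]
      _ = ∑ l with A l j = 1, ∑ i, ‖(A ^ k) i l‖₊ := by
          rw [Finset.sum_filter]
          refine Finset.sum_congr rfl fun l _ => ?_
          rcases hA l j with h | h <;> simp [h]
      _ ≤ ∑ l with A l j = 1, ((pathsFrom A k l).card : NNReal) :=
          Finset.sum_le_sum fun l _ => ih l
      _ ≤ (pathsFrom A (k + 1) j).card := by
          exact_mod_cast sum_card_pathsFrom_le A k j _ (by simp)

/-- The operator norm for the sup norm is the largest row sum, and each entry is at most its column
sum. -/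
lemma spectralRadius_pow_le_sum_card_pathsFrom {n : ℕ} [NeZero n] {A : Matrix (Fin n) (Fin n) ℂ}
    (hA : ∀ i j, A i j = 0 ∨ A i j = 1) (k : ℕ) :
    spectralRadius ℂ A ^ k ≤ ((∑ j, (pathsFrom A k j).card : ℕ) : ENNReal) := by
  let _ : NormedRing (Matrix (Fin n) (Fin n) ℂ) := Matrix.linftyOpNormedRing
  let _ : NormedAlgebra ℂ (Matrix (Fin n) (Fin n) ℂ) := Matrix.linftyOpNormedAlgebra
  have : NormOneClass (Matrix (Fin n) (Fin n) ℂ) := Matrix.linfty_opNormOneClass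
  have : CompleteSpace (Matrix (Fin n) (Fin n) ℂ) := FiniteDimensional.complete ℂ _
  have h1 : ‖A ^ k‖₊ ≤ ((∑ j, (pathsFrom A k j).card : ℕ) : NNReal) := by
    rw [Matrix.linfty_opNNNorm_def, Finset.sup_le_iff]
    intro i _
    push_cast
    refine Finset.sum_le_sum fun j _ => le_trans ?_ (sum_nnnorm_pow_apply_le hA k j)
    exact Finset.single_le_sum (f := fun i => ‖(A ^ k) i j‖₊) (fun _ _ => zero_le) (Finset.mem_univ i)
  have h2 : spectralRadius ℂ A ^ k ≤ (‖A ^ k‖₊ : ENNReal) := by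
    rcases k.eq_zero_or_pos with rfl | hk
    · simp
    · exact (spectrum.spectralRadius_pow_le A k hk.ne').trans (spectrum.spectralRadius_le_nnnorm _)
  exact h2.trans (by exact_mod_cast h1)

lemma spectralRadius_ne_top {n : ℕ} [NeZero n] {A : Matrix (Fin n) (Fin n) ℂ}
    (hA : ∀ i j, A i j = 0 ∨ A i j = 1) : spectralRadius ℂ A ≠ ⊤ := by
  have := spectralRadius_pow_le_sum_card_pathsFrom hA 1
  rw [pow_one] at this
  exact ne_top_of_le_ne_top (ENNReal.natCast_ne_top _) this

/-- Two admissible sequences are related when they agree at time `0`. -/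
def sameSymbol {n : ℕ} (A : Matrix (Fin n) (Fin n) ℂ) :
    SetRel (AdmissibleSeq A) (AdmissibleSeq A) :=
  {p | p.1.1 0 = p.2.1 0}

lemma shiftMap_iterate_apply {n : ℕ} (A : Matrix (Fin n) (Fin n) ℂ) (t : ℕ) (x : AdmissibleSeq A)
    (z : ℤ) : ((shiftMap A)^[t] x).1 z = x.1 (z + t) := by
  induction t generalizing x with
  | zero => simp
  | succ t ih =>
    rw [Function.iterate_succ_apply, ih]
    simp only [shiftMap]
    rw [add_assoc, Nat.cast_succ]

/-- A path is determined by a cover element tracking its middle `m` symbols, its first `n` symbols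
and its last `n + 1`. -/
lemma sum_card_pathsFrom_le_card_mul {n : ℕ} (A : Matrix (Fin n) (Fin n) ℂ) (m : ℕ)
    {s : Finset (AdmissibleSeq A)}
    (hs : IsDynCoverOf (shiftMap A) univ (sameSymbol A) m (s : Set (AdmissibleSeq A))) :
    ∑ j, (pathsFrom A (n + m + n) j).card ≤ s.card * (n ^ n * n ^ (n + 1)) := by
  classical
  rw [← Finset.card_biUnion fun l _ l' _ hl => Finset.disjoint_left.2 fun w hw hw' =>
    hl ((mem_pathsFrom.1 hw).1.symm.trans (mem_pathsFrom.1 hw').1)]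
  have key : ∀ w ∈ Finset.univ.biUnion (pathsFrom A (n + m + n)),
      ∃ y ∈ s, ∀ t (ht : t < m), y.1 (t : ℤ) = w ⟨n + t, by lia⟩ := by
    intro w hw
    obtain ⟨j, -, hw⟩ := Finset.mem_biUnion.1 hw
    obtain ⟨-, hw⟩ := mem_pathsFrom.1 hw
    obtain ⟨x, hxw, hx⟩ := exists_biinfinite_path (fun a b => A b a = 1)
      -- Clamping extends `w` to all of `ℤ`; the values outside its range are irrelevant.
      (fun z => w ⟨min z.toNat (n + m + n), by lia⟩) 0 ((n + m + n : ℕ) : ℤ) n ((n + m : ℕ) : ℤ)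
      (by simp) (by lia) (by simp) (fun z h0 h1 => by
        convert hw ⟨z.toNat, by lia⟩ using 3
        · simp; lia
        · simp; lia)
    let x' : AdmissibleSeq A := ⟨fun z => x (z + n), fun z => by
      have := hx (z + n)
      rwa [show z + n + 1 = z + 1 + n by ring] at this⟩
    obtain ⟨y, hy, hxy⟩ := hs (mem_univ x')
    refine ⟨y, hy, fun t ht => ?_⟩
    have h := mem_dynEntourage.1 hxy t ht
    simp only [sameSymbol, mem_ofPred_eq, shiftMap_iterate_apply, zero_add] at h
    rw [← h]
    change x (t + n) = _
    rw [hxw _ (by lia) (by lia)]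
    congr 2
    lia
  rcases isEmpty_or_nonempty (AdmissibleSeq A) with hempty | hne
  · rw [Finset.card_eq_zero.2 (Finset.eq_empty_of_forall_notMem fun w hw =>
      (key w hw).elim fun y _ => hempty.elim y)]
    exact Nat.zero_le _
  choose! y hys hy using key
  let Φ : (Fin (n + m + n + 1) → Fin n) →
      AdmissibleSeq A × (Fin n → Fin n) × (Fin (n + 1) → Fin n) := fun w =>
    (y w, fun t => w ⟨t, by lia⟩, fun t => w ⟨n + m + t, by lia⟩)
  have hcard : (s ×ˢ (Finset.univ : Finset ((Fin n → Fin n) × (Fin (n + 1) → Fin n)))).card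
      = s.card * (n ^ n * n ^ (n + 1)) := by
    simp [Finset.card_product]
  rw [← hcard]
  refine Finset.card_le_card_of_injOn Φ (fun w hw => ?_) fun w hw w' hw' h => ?_
  · simpa [Φ] using hys w hw
  · simp only [Φ, Prod.mk.injEq] at h
    obtain ⟨h1, h2, h3⟩ := h
    ext ⟨t, ht⟩ : 1
    rcases lt_or_ge t n with h | h
    · exact congrFun h2 ⟨t, h⟩
    rcases lt_or_ge t (n + m) with h' | h'
    · have e := hy w hw (t - n) (by lia)
      have e' := hy w' hw' (t - n) (by lia)
      rw [h1, e'] at e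
      simpa [Nat.add_sub_cancel' h] using e.symm
    · simpa [Nat.add_sub_cancel' h'] using congrFun h3 ⟨t - (n + m), by lia⟩

/-- The entropy of the subshift, at the scale of the generating partition by the symbol at time `0`,
is at least the logarithm of the spectral radius of its transition matrix. -/
theorem log_spectralRadius_le_coverEntropyEntourage {n : ℕ} {A : Matrix (Fin n) (Fin n) ℂ}
    (hA : ∀ i j, A i j = 0 ∨ A i j = 1) :
    ENNReal.log (spectralRadius ℂ A) ≤
      coverEntropyEntourage (shiftMap A) univ (sameSymbol A) := by
  rcases eq_or_ne (spectralRadius ℂ A) 0 with h0 | h0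
  · simp [h0]
  have : NeZero n := ⟨by
    rintro rfl
    exact h0 (by simp [spectralRadius])⟩
  have hbound (m : ℕ) : spectralRadius ℂ A ^ (n + m + n) ≤
      (n ^ n * n ^ (n + 1) : ℕ) *
        ((coverMincard (shiftMap A) univ (sameSymbol A) m : ℕ∞) : ENNReal) := by
    rcases eq_top_or_lt_top (coverMincard (shiftMap A) univ (sameSymbol A) m) with h | h
    · rw [h, ENat.toENNReal_top, ENNReal.mul_top (by simp [NeZero.ne n])]
      exact le_top
    · obtain ⟨s, hs, hcard⟩ := (coverMincard_finite_iff _ _ _ _).1 h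
      rw [← hcard]
      refine (spectralRadius_pow_le_sum_card_pathsFrom hA _).trans ?_
      rw [mul_comm, ENat.toENNReal_coe]
      exact_mod_cast sum_card_pathsFrom_le_card_mul A m hs
  have hr := spectralRadius_ne_top hA
  rw [← expGrowthSup_pow]
  refine expGrowthSup_le_of_eventually_le
    (b := (spectralRadius ℂ A ^ (n + n))⁻¹ * (n ^ n * n ^ (n + 1) : ℕ))
    (ENNReal.mul_ne_top (ENNReal.inv_ne_top.2 (pow_ne_zero _ h0)) (ENNReal.natCast_ne_top _))
    (Eventually.of_forall fun m => ?_)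
  calc spectralRadius ℂ A ^ m
      = (spectralRadius ℂ A ^ (n + n))⁻¹ * spectralRadius ℂ A ^ (n + m + n) := by
        rw [show n + m + n = n + n + m by ring, pow_add _ (n + n) m, ← mul_assoc,
          ENNReal.inv_mul_cancel (pow_ne_zero _ h0) (ENNReal.pow_ne_top hr), one_mul]
    _ ≤ _ := by
        rw [mul_assoc]
        gcongr
        exact hbound m

theorem lemma5p14 {X : Type*} [UniformSpace X] (f : X → X) (hf : Continuous f)
    (S : Set X) (hS : IsCompact S) (hinv : Set.MapsTo f S S)
    (n : ℕ) (A : Matrix (Fin n) (Fin n) ℂ) (hA : ∀ i j, A i j = 0 ∨ A i j = 1)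
    (π : S → AdmissibleSeq A) (hπ_cont : Continuous π) (hπ_surj : Function.Surjective π)
    (hπ : shiftMap A ∘ π = π ∘ hinv.restrict f S S) :
    ENNReal.log (spectralRadius ℂ A) ≤ topologicalEntropy f := by
  have hsemi : Function.Semiconj π (hinv.restrict f S S) (shiftMap A) :=
    fun x => (congrFun hπ x).symm
  have hU : Prod.map π π ⁻¹' sameSymbol A ∈ 𝓤 S := by
    have : CompactSpace S := isCompact_iff_compactSpace.1 hS
    -- For the discrete uniformity the diagonal is an entourage, and it pulls back to one by uniform
    -- continuity on compact `S`.
    let _ : UniformSpace (Fin n) := ⊥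
    have hcont : Continuous fun a : S => (π a).1 0 :=
      (continuous_apply 0).comp (continuous_subtype_val.comp hπ_cont)
    exact CompactSpace.uniformContinuous_of_continuous hcont (mem_principal_self _)
  calc ENNReal.log (spectralRadius ℂ A)
      ≤ coverEntropyEntourage (shiftMap A) univ (sameSymbol A) :=
        log_spectralRadius_le_coverEntropyEntourage hA
    _ = coverEntropyEntourage (shiftMap A) (π '' univ) (sameSymbol A) := by
        rw [image_univ, hπ_surj.range_eq]
    _ ≤ coverEntropyEntourage (hinv.restrict f S S) univ (Prod.map π π ⁻¹' sameSymbol A) :=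
        coverEntropyEntourage_image_le hsemi _ _
    _ ≤ coverEntropy (hinv.restrict f S S) univ := coverEntropyEntourage_le_coverEntropy _ _ hU
    _ = coverEntropy f S := coverEntropy_restrict hinv
    _ ≤ topologicalEntropy f := le_iSup₂_of_le S hS le_rfl
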